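/- All C*-algebras and $*$-homomorphisms are unital; all graphs are finite and simple. A \emph{magic unitary} is a square matrix of projections in which distinct entries of a same row or of a same column are orthogonal and every row and every column sums to $1$. For a finite graph $X$ with adjacency matrix $d_X$, let $A(X)$ be the universal C*-algebra generated by the entries of a magic unitary $u=(u_{ij})_{i,j\in X}$ subject to $d_Xu=ud_X$ (the C*-algebra of the quantum automorphism group of $X$). For finite graphs $X$, $Y$, let $A(X)*_wA(Y)$ be the free wreath product: the quotient of the C*-algebraic free product $A(X)^{*Y}*A(Y)$ (one copy of $A(X)$ for each vertex of $Y$, with canonical maps $\nu_a:A(X)\to A(X)^{*Y}$, $a\in Y$) by the relations $\nu_a(x)v_{ab}=v_{ab}\nu_a(x)$ for $x\in A(X)$ and $a,b\in Y$, where $v=(v_{ab})$ is the generating magic unitary of $A(Y)$. The lexicographic product $X\circ Y$ has vertex set $X\times Y$, with $(i,a)\sim(j,b)$ if and only if ($a=b$ and $i\sim j$) or $a\sim b$. Write $\mathcal V(y)$ for the set of neighbours of $y$ in $Y$, $X^c$ for the complement of $X$, and $$S_Y=\{(y_0,y_1)\in Y^2 : \mathcal V(y_0)=\mathcal V(y_1),\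 y_0\neq y_1\},\qquad T_Y=\{(y_0,y_1)\in Y^2 : \mathcal V(y_0)\cup\{y_0\}=\mathcal V(y_1)\cup\{y_1\},\ y_0\neq y_1\}.$$ \textbf{Theorem.} Let $X$ and $Y$ be finite graphs (for instance, finite regular graphs) such that $A(X\circ Y)\cong A(X)*_wA(Y)$ as C*-algebras (in particular, this holds if they are isomorphic as Woronowicz algebras). Then: \begin{enumerate} \item $\mathrm{Aut}(X\circ Y)\cong\mathrm{Aut}(X)\wr\mathrm{Aut}(Y)$, where the wreath product is the semidirect product $\mathrm{Aut}(X)^{Y}\rtimes\mathrm{Aut}(Y)$ for the action $(\tau\cdot\sigma)_a=\sigma_{\tau^{-1}(a)}$; more precisely, the canonical homomorphism $\mathrm{Aut}(X)\wr\mathrm{Aut}(Y)\to\mathrm{Aut}(X\circ Y)$ sending $(\sigma,\tau)$ to $(i,a)\mapsto(\sigma_{\tau(a)}(i),\tau(a))$ is an isomorphism; \item if $S_Y\neq\emptyset$, then $X$ is connected; \item if $T_Y\neq\emptyset$, then $X^c$ is connected. \end{enumerate} -/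

import Mathlib

open scoped ENNReal

universe u v w

/-! ### Universal C⋆-algebras -/

/-- A system of relations between elements `ρ x` (`x : G`) of a unital C⋆-algebra which bounds the
norm of each `ρ x`, so that the universal unital C⋆-algebra with these generators and relations
exists. (A C⋆-algebra generated by a family indexed by `G : Type u` always has a copy in `Type u`,
so the C⋆-algebras of this universe are all that has to be considered.) -/
structure CStarRelations (G : Type u) where
  /-- The family `ρ` satisfies the relations. -/
  Holds : ∀ (C : Type u) [CStarAlgebra C], (G → C) → Prop
  bounded : ∀ x : G, ∃ K : ℝ, ∀ (C : Type u) [CStarAlgebra C] (ρ : G → C),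
    Holds C ρ → ‖ρ x‖ ≤ K

namespace CStarRelations

variable {G : Type u} (R : CStarRelations G)

/-- A realization of the relations in a nonzero unital C⋆-algebra. -/
structure Realization where
  /-- The target C⋆-algebra. -/
  C : Type u
  [inst : CStarAlgebra C]
  [nontriv : Nontrivial C]
  /-- The images of the generators. -/
  ρ : G → C
  holds : R.Holds C ρ

attribute [instance] Realization.inst Realization.nontriv

/-- The `ℓ^∞`-product of the targets of all realizations. -/
abbrev Ambient : Type (u + 1) := lp (fun r : R.Realization => r.C) ∞

noncomputable instance : CStarAlgebra R.Ambient where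

/-- The family `(ρ x)_ρ` over all realizations `ρ`. -/
noncomputable def ambientGen (x : G) : R.Ambient :=
  ⟨fun r => r.ρ x, memℓp_infty (by
    obtain ⟨K, hK⟩ := R.bounded x
    refine ⟨K, ?_⟩
    rintro _ ⟨r, rfl⟩
    exact hK r.C r.ρ r.holds)⟩

/-- The universal unital C⋆-algebra with generators `G` and relations `R`: the C⋆-algebra generated
by the generators in the product of all realizations. Equivalently, it is the completion of the free
unital `*`-algebra on `G` for the largest C⋆-seminorm coming from realizations of `R`. -/
noncomputable def universalAlgebra : StarSubalgebra ℂ R.Ambient :=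
  (StarAlgebra.adjoin ℂ (Set.range R.ambientGen)).topologicalClosure

/-- The universal C⋆-algebra as a type. -/
abbrev Universal : Type (u + 1) := R.universalAlgebra

noncomputable instance : CStarAlgebra R.Universal :=
  StarSubalgebra.cstarAlgebra R.universalAlgebra
    (h_closed := StarSubalgebra.isClosed_topologicalClosure _)

/-- The canonical generators of the universal C⋆-algebra. -/
noncomputable def gen (x : G) : R.Universal :=
  ⟨R.ambientGen x, StarSubalgebra.le_topologicalClosure _
    (StarAlgebra.subset_adjoin ℂ _ (Set.mem_range_self x))⟩

end CStarRelations

/-! ### Magic unitaries and the quantum automorphism algebra of a graph -/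

/-- A magic unitary: a square matrix of projections, distinct entries of one row or of one column
being orthogonal, all of whose rows and columns sum to `1`. -/
structure IsMagicUnitary {n : Type*} [Fintype n] {C : Type*} [CStarAlgebra C]
    (m : Matrix n n C) : Prop where
  proj : ∀ i j, IsStarProjection (m i j)
  row_orth : ∀ i j k, j ≠ k → m i j * m i k = 0
  col_orth : ∀ i j k, i ≠ j → m i k * m j k = 0
  row_sum : ∀ i, ∑ j, m i j = 1
  col_sum : ∀ j, ∑ i, m i j = 1

open Classical in
/-- The relations on `(u i j)` saying that `u` is a magic unitary commuting with the adjacency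
matrix of `X`. -/
noncomputable def graphRelations {V : Type u} [Fintype V] (X : SimpleGraph V) :
    CStarRelations (V × V) where
  Holds C _ ρ := IsMagicUnitary (Matrix.of fun i j => ρ (i, j)) ∧
    X.adjMatrix C * (Matrix.of fun i j => ρ (i, j)) =
      (Matrix.of fun i j => ρ (i, j)) * X.adjMatrix C
  bounded x := ⟨1, fun _ _ _ h => (h.1.proj x.1 x.2).norm_le⟩

/-- The C⋆-algebra `A(X) = C(𝔾_X)` of the quantum automorphism group of the finite graph `X`. -/
abbrev QAut {V : Type u} [Fintype V] (X : SimpleGraph V) : Type (u + 1) :=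
  (graphRelations X).Universal

/-- The generating magic unitary of `A(X)`. -/
noncomputable def QAut.u {V : Type u} [Fintype V] (X : SimpleGraph V) :
    Matrix V V (QAut X) :=
  Matrix.of fun i j => (graphRelations X).gen (i, j)

/-! ### Free wreath products -/

/-- The relations of the free wreath product of `A` by an algebra `H` generated by a magic unitary
`m` of size `n`: the elements `(k, a)`, `a : A`, form the image of `a` under a unital
`*`-homomorphism `ν k : A → C` for each `k : n`, the elements of `H` are sent to `C` by a unital
`*`-homomorphism `μ` (so far these are the relations of the free product `A^{*n} * H`), and
`ν k a` commutes with `μ (m k i)`. -/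
noncomputable def freeWreathRelations (A : Type u) [CStarAlgebra A] {n : Type w} {H : Type v} [CStarAlgebra H]
    (m : Matrix n n H) : CStarRelations ((n × A) ⊕ H) where
  Holds C _ ρ := ∃ (ν : n → (A →⋆ₐ[ℂ] C)) (μ : H →⋆ₐ[ℂ] C),
    (∀ k a, ρ (Sum.inl (k, a)) = ν k a) ∧ (∀ h, ρ (Sum.inr h) = μ h) ∧
      ∀ (k i : n) (a : A), ν k a * μ (m k i) = μ (m k i) * ν k a
  bounded := by
    rintro (⟨k, a⟩ | h)
    · refine ⟨‖a‖, ?_⟩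
      rintro C _ ρ ⟨ν, μ, h₁, -, -⟩
      rw [h₁]
      exact NonUnitalStarAlgHom.norm_apply_le (ν k) a
    · refine ⟨‖h‖, ?_⟩
      rintro C _ ρ ⟨ν, μ, -, h₂, -⟩
      rw [h₂]
      exact NonUnitalStarAlgHom.norm_apply_le μ h

/-- The free wreath product `A *_w H`, where `m` is the generating magic unitary of `H`. -/
abbrev FreeWreath (A : Type u) [CStarAlgebra A] {n : Type w} {H : Type v} [CStarAlgebra H]
    (m : Matrix n n H) : Type (max u v w + 1) :=
  (freeWreathRelations A m).Universal

/-! ### Graphs -/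

namespace SimpleGraph

/-- The lexicographic product `X ∘ Y`: a copy of `X` at each vertex of `Y`. -/
def lexProd {V : Type u} {W : Type v} (X : SimpleGraph V) (Y : SimpleGraph W) :
    SimpleGraph (V × W) where
  Adj p q := (p.2 = q.2 ∧ X.Adj p.1 q.1) ∨ Y.Adj p.2 q.2
  symm := ⟨fun _ _ h => h.imp (fun h => ⟨h.1.symm, h.2.symm⟩) (fun h => h.symm)⟩
  loopless := ⟨fun _ h => h.elim (fun h => X.loopless.irrefl _ h.2) (fun h => Y.loopless.irrefl _ h)⟩

/-- `S_Y`: the pairs of distinct vertices with the same neighbours. -/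
def twinPairs {W : Type v} (Y : SimpleGraph W) : Set (W × W) :=
  {p | Y.neighborSet p.1 = Y.neighborSet p.2 ∧ p.1 ≠ p.2}

/-- `T_Y`: the pairs of distinct vertices `y₀`, `y₁` with `V(y₀) ∪ {y₀} = V(y₁) ∪ {y₁}`. -/
def closedTwinPairs {W : Type v} (Y : SimpleGraph W) : Set (W × W) :=
  {p | insert p.1 (Y.neighborSet p.1) = insert p.2 (Y.neighborSet p.2) ∧ p.1 ≠ p.2}

/-- The wreath product `Aut(X) ≀ Aut(Y)`, the semidirect product of `Aut(X)^W` by `Aut(Y)` for the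
action `(τ • σ) b = σ (τ⁻¹ b)`. -/
abbrev AutWreath {V : Type u} {W : Type v} (X : SimpleGraph V) (Y : SimpleGraph W) : Type (max u v) :=
  (W → (X ≃g X)) ⋊[mulAutArrow (G := Y ≃g Y) (A := W) (M := X ≃g X)] (Y ≃g Y)

end SimpleGraph

/-! The proof counts characters (unital `*`-homomorphisms to `ℂ`), which an isomorphism of
C⋆-algebras preserves in number. A magic unitary over `ℂ` is a permutation matrix, so the characters
of `A(X)` correspond to `Aut(X)` (`QAut.exists_bijective_character`). In a free wreath product the
commutation relations are vacuous for characters, which are thus one character of `A(X)` per vertex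
of `Y` and one of `A(Y)` (`FreeWreath.bijective_characters`). Hence `Aut(X ∘ Y)` has the order of
`Aut(X) ≀ Aut(Y)`, and the canonical homomorphism, once injective, is bijective.

Every automorphism of `X ∘ Y` therefore permutes the copies of `X`. If `y₀`, `y₁` are twins and `X`
is disconnected, exchanging the copies over `y₀` and `y₁` along a single component of `X`
contradicts this (`connected_of_twinPairs`). Complementation, which turns closed twins into twins,
gives the last claim.

When `X` has no vertices injectivity is not automatic; there the cardinalities force `Aut(Y)` to be
trivial, so `Y` has no twins of either kind. -/

/-! ### Characters of a universal C⋆-algebra -/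

namespace CStarRelations

variable {G : Type u} (R : CStarRelations G)

/-- The `*`-homomorphism from the universal C⋆-algebra to the target of a realization. -/
noncomputable def Realization.lift (r : R.Realization) : R.Universal →⋆ₐ[ℂ] r.C where
  toFun a := (a : R.Ambient) r
  map_one' := rfl
  map_mul' _ _ := rfl
  map_zero' := rfl
  map_add' _ _ := rfl
  commutes' _ := rfl
  map_star' _ := rfl

variable {R}

@[simp]
theorem Realization.lift_gen (r : R.Realization) (x : G) : r.lift R (R.gen x) = r.ρ x := rfl

theorem Universal.ext_lift {a b : R.Universal}
    (h : ∀ r : R.Realization, r.lift R a = r.lift R b) : a = b :=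
  Subtype.ext (lp.ext (funext h))

/-- `*`-homomorphisms are contractive, hence continuous, and the generators span a dense
`*`-subalgebra under the algebra operations. -/
theorem Universal.starAlgHom_ext {B : Type*} [CStarAlgebra B] {φ ψ : R.Universal →⋆ₐ[ℂ] B}
    (h : ∀ x, φ (R.gen x) = ψ (R.gen x)) : φ = ψ := by
  have hφ : Continuous φ := AddMonoidHomClass.continuous_of_bound φ 1 fun a => by
    simpa using NonUnitalStarAlgHom.norm_apply_le φ a
  have hψ : Continuous ψ := AddMonoidHomClass.continuous_of_bound ψ 1 fun a => by
    simpa using NonUnitalStarAlgHom.norm_apply_le ψ a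
  refine StarAlgHom.ext_topologicalClosure hφ hψ ?_
  refine StarAlgHom.ext fun x => ?_
  refine congrFun (congrArg DFunLike.coe (StarAlgHom.ext_adjoin (s := Set.range R.ambientGen)
    (f := φ.comp (StarSubalgebra.inclusion (StarSubalgebra.le_topologicalClosure _)))
    (g := ψ.comp (StarSubalgebra.inclusion (StarSubalgebra.le_topologicalClosure _))) ?_)) x
  rintro ⟨_, _⟩ ⟨y, rfl⟩
  exact h y

/-- A copy of `ℂ` in an arbitrary universe. -/
abbrev Scalars : Type u := C(PUnit.{u + 1}, ℂ)

/-- The embedding of `ℂ` in its copy. -/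
noncomputable def toScalars : ℂ →⋆ₐ[ℂ] Scalars.{u} :=
  StarAlgHom.ofId ℂ Scalars.{u}

/-- The relations are only tested in C⋆-algebras of the universe of `G`, so scalar values enter as a
realization in `Scalars`; the character is its coordinate followed by evaluation at the point. -/
theorem exists_character {ρ : G → ℂ} (h : R.Holds Scalars.{u} (fun x => toScalars (ρ x))) :
    ∃ φ : R.Universal →⋆ₐ[ℂ] ℂ, ∀ x, φ (R.gen x) = ρ x := by
  let r : R.Realization := { C := Scalars.{u}, ρ := fun x => toScalars (ρ x), holds := h }
  exact ⟨(ContinuousMap.evalStarAlgHom ℂ ℂ PUnit.unit).comp (r.lift R), fun x => rfl⟩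

end CStarRelations

open CStarRelations

/-! ### Characters of `A(X)` -/

theorem IsMagicUnitary.map {n : Type*} [Fintype n] {C D : Type*} [CStarAlgebra C] [CStarAlgebra D]
    {m : Matrix n n C} (hm : IsMagicUnitary m) (φ : C →⋆ₐ[ℂ] D) : IsMagicUnitary (m.map φ) where
  proj i j := (hm.proj i j).map φ
  row_orth i j k h := by simp [← map_mul, hm.row_orth i j k h]
  col_orth i j k h := by simp [← map_mul, hm.col_orth i j k h]
  row_sum i := by simp [← map_sum, hm.row_sum i]
  col_sum j := by simp [← map_sum, hm.col_sum j]

theorem isMagicUnitary_of_equiv {n : Type*} [Fintype n] [DecidableEq n] (σ : n ≃ n) :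
    IsMagicUnitary (Matrix.of fun i j => if i = σ j then (1 : ℂ) else 0) where
  proj i j := by
    simp only [Matrix.of_apply]
    split_ifs <;> simp [isStarProjection_iff, IsIdempotentElem, IsSelfAdjoint]
  row_orth i j k h := by
    simp only [Matrix.of_apply]
    split_ifs with h1 h2 <;> simp
    exact h (σ.injective (h1.symm.trans h2))
  col_orth i j k h := by
    simp only [Matrix.of_apply]
    split_ifs with h1 h2 <;> simp
    exact h (h1.trans h2.symm)
  row_sum i := by simp [← σ.symm_apply_eq]
  col_sum j := by simp

/-- Idempotents of `ℂ` are `0` or `1`; the sums give a `1` in each row and column, and orthogonality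
makes it unique. -/
theorem IsMagicUnitary.exists_equiv {n : Type*} [Fintype n] [DecidableEq n] {m : Matrix n n ℂ}
    (hm : IsMagicUnitary m) : ∃ σ : n ≃ n, ∀ i j, m i j = if i = σ j then 1 else 0 := by
  have h01 : ∀ i j, m i j = 0 ∨ m i j = 1 := fun i j =>
    IsIdempotentElem.iff_eq_zero_or_one.mp (hm.proj i j).isIdempotentElem
  have hcol : ∀ j, ∃ i, m i j = 1 := fun j => by
    by_contra! h
    have := hm.col_sum j
    rw [Finset.sum_eq_zero fun i _ => (h01 i j).resolve_right (h i)] at this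
    exact zero_ne_one this
  have hrow : ∀ i, ∃ j, m i j = 1 := fun i => by
    by_contra! h
    have := hm.row_sum i
    rw [Finset.sum_eq_zero fun j _ => (h01 i j).resolve_right (h j)] at this
    exact zero_ne_one this
  choose f hf using hcol
  choose g hg using hrow
  have huc : ∀ {i i' j}, m i j = 1 → m i' j = 1 → i = i' := fun {i i' j} h h' => by
    by_contra hne
    simpa [h, h'] using hm.col_orth i i' j hne
  have hur : ∀ {i j j'}, m i j = 1 → m i j' = 1 → j = j' := fun {i j j'} h h' => by
    by_contra hne
    simpa [h, h'] using hm.row_orth i j j' hne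
  refine ⟨⟨f, g, fun j => hur (hg _) (hf j), fun i => huc (hf _) (hg i)⟩, fun i j => ?_⟩
  split_ifs with h
  · exact h ▸ hf j
  · exact (h01 i j).resolve_right fun h1 => h (huc h1 (hf j))

open Classical in
theorem adjMatrix_mul_comm_iff {V : Type*} [Fintype V] (X : SimpleGraph V) (σ : V ≃ V) :
    X.adjMatrix ℂ * (Matrix.of fun i j => if i = σ j then (1 : ℂ) else 0) =
      (Matrix.of fun i j => if i = σ j then (1 : ℂ) else 0) * X.adjMatrix ℂ ↔
    ∀ i j, X.Adj (σ i) (σ j) ↔ X.Adj i j := by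
  -- Row `σ i` makes both products collapse to one adjacency entry each: `(σ i, σ j)` on the left,
  -- `(i, j)` on the right.
  have key : ∀ i j, ((X.adjMatrix ℂ * (Matrix.of fun i j => if i = σ j then (1 : ℂ) else 0))
      (σ i) j = ((Matrix.of fun i j => if i = σ j then (1 : ℂ) else 0) * X.adjMatrix ℂ) (σ i) j) ↔
      (X.Adj (σ i) (σ j) ↔ X.Adj i j) := fun i j => by
    rw [Matrix.mul_apply, Matrix.mul_apply]
    simp only [Matrix.of_apply, boole_mul, σ.injective.eq_iff, Finset.sum_ite_eq, Finset.mem_univ,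
      if_true]
    simp only [mul_boole, Finset.sum_ite_eq', Finset.mem_univ, if_true, SimpleGraph.adjMatrix_apply]
    split_ifs <;> simp_all
  rw [← Matrix.ext_iff]
  exact ⟨fun h i j => (key i j).1 (h _ _), fun h i j => by
    obtain ⟨i, rfl⟩ := σ.surjective i
    exact (key i j).2 (h i j)⟩

theorem QAut.isMagicUnitary_u {V : Type u} [Fintype V] (X : SimpleGraph V) :
    IsMagicUnitary (QAut.u X) where
  proj i j := by
    refine ⟨Universal.ext_lift fun r => ?_, Universal.ext_lift fun r => ?_⟩
    · rw [map_mul]; exact (r.holds.1.proj i j).isIdempotentElem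
    · rw [map_star]; exact (r.holds.1.proj i j).isSelfAdjoint
  row_orth i j k h := Universal.ext_lift fun r => by
    rw [map_mul, map_zero]; exact r.holds.1.row_orth i j k h
  col_orth i j k h := Universal.ext_lift fun r => by
    rw [map_mul, map_zero]; exact r.holds.1.col_orth i j k h
  row_sum i := Universal.ext_lift fun r => by
    rw [map_sum, map_one]; exact r.holds.1.row_sum i
  col_sum j := Universal.ext_lift fun r => by
    rw [map_sum, map_one]; exact r.holds.1.col_sum j

open Classical in
theorem SimpleGraph.map_adjMatrix {V C D F : Type*} [NonAssocSemiring C] [NonAssocSemiring D]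
    [FunLike F C D] [RingHomClass F C D] (X : SimpleGraph V) (φ : F) :
    (X.adjMatrix C).map φ = X.adjMatrix D := by
  ext i j
  simp only [Matrix.map_apply, adjMatrix_apply]
  split_ifs <;> simp

open Classical in
theorem QAut.adjMatrix_mul_u {V : Type u} [Fintype V] (X : SimpleGraph V) :
    X.adjMatrix (QAut X) * QAut.u X = QAut.u X * X.adjMatrix (QAut X) := by
  refine Matrix.ext fun i j => Universal.ext_lift fun r => ?_
  have h := congrFun (congrFun r.holds.2 i) j
  rw [← X.map_adjMatrix (r.lift (graphRelations X))] at h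
  simp only [Matrix.mul_apply, map_sum, map_mul]
  rw [Matrix.mul_apply, Matrix.mul_apply] at h
  exact h

open Classical in
theorem QAut.exists_character {V : Type u} [Fintype V] (X : SimpleGraph V) (σ : X ≃g X) :
    ∃ φ : QAut X →⋆ₐ[ℂ] ℂ, ∀ i j, φ (QAut.u X i j) = if i = σ j then 1 else 0 := by
  obtain ⟨φ, hφ⟩ := CStarRelations.exists_character (R := graphRelations X)
    (ρ := fun p => if p.1 = σ p.2 then 1 else 0)
    ⟨(isMagicUnitary_of_equiv σ.toEquiv).map toScalars, by
      have h := (adjMatrix_mul_comm_iff X σ.toEquiv).2 fun i j => σ.map_adj_iff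
      have h' := congrArg (fun M => M.map (toScalars.{u} : ℂ →⋆ₐ[ℂ] Scalars.{u})) h
      simp only [Matrix.map_mul, X.map_adjMatrix] at h'
      exact h'⟩
  exact ⟨φ, fun i j => hφ (i, j)⟩

open Classical in
/-- The characters of `A(X)` are the automorphisms of `X`. -/
theorem QAut.exists_bijective_character {V : Type u} [Fintype V] (X : SimpleGraph V) :
    ∃ F : (X ≃g X) → (QAut X →⋆ₐ[ℂ] ℂ), Function.Bijective F := by
  choose F hF using QAut.exists_character X
  refine ⟨F, fun σ τ h => ?_, fun φ => ?_⟩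
  · refine RelIso.ext fun j => ?_
    have h1 := hF σ (σ j) j
    rw [h, hF τ, if_pos rfl] at h1
    by_contra hne
    simp [hne] at h1
  · obtain ⟨σ, hσ⟩ := ((QAut.isMagicUnitary_u X).map φ).exists_equiv
    have hm : (QAut.u X).map φ = Matrix.of fun i j => if i = σ j then (1 : ℂ) else 0 := by
      ext i j; exact hσ i j
    have h := congrArg (fun M => M.map φ) (QAut.adjMatrix_mul_u X)
    simp only [Matrix.map_mul, X.map_adjMatrix, hm] at h
    refine ⟨⟨σ, (adjMatrix_mul_comm_iff X σ).1 h _ _⟩, Universal.starAlgHom_ext fun p => ?_⟩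
    exact (hF _ p.1 p.2).trans (hσ p.1 p.2).symm

theorem QAut.card_character {V : Type u} [Fintype V] (X : SimpleGraph V) :
    Nat.card (QAut X →⋆ₐ[ℂ] ℂ) = Nat.card (X ≃g X) := by
  obtain ⟨F, hF⟩ := QAut.exists_bijective_character X
  exact (Nat.card_eq_of_bijective F hF).symm

/-! ### Characters of the free wreath product -/

namespace FreeWreath

variable {A : Type u} [CStarAlgebra A] {n : Type w} {H : Type v} [CStarAlgebra H]
  (m : Matrix n n H)

/-- The `k`-th canonical map from `A` to `A *_w H`. -/
noncomputable def ν (k : n) : A →⋆ₐ[ℂ] FreeWreath A m where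
  toFun a := (freeWreathRelations A m).gen (Sum.inl (k, a))
  map_one' := Universal.ext_lift fun r => by
    obtain ⟨ν, μ, h, -⟩ := r.holds
    simp [h]
  map_mul' a b := Universal.ext_lift fun r => by
    obtain ⟨ν, μ, h, -⟩ := r.holds
    simp [h]
  map_zero' := Universal.ext_lift fun r => by
    obtain ⟨ν, μ, h, -⟩ := r.holds
    simp [h]
  map_add' a b := Universal.ext_lift fun r => by
    obtain ⟨ν, μ, h, -⟩ := r.holds
    simp [h]
  commutes' z := Universal.ext_lift fun r => by
    obtain ⟨ν, μ, h, -⟩ := r.holds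
    simp [h, AlgHomClass.commutes]
  map_star' a := Universal.ext_lift fun r => by
    obtain ⟨ν, μ, h, -⟩ := r.holds
    simp [h, map_star]

/-- The canonical map from `H` to `A *_w H`. -/
noncomputable def μ : H →⋆ₐ[ℂ] FreeWreath A m where
  toFun a := (freeWreathRelations A m).gen (Sum.inr a)
  map_one' := Universal.ext_lift fun r => by
    obtain ⟨ν, μ, -, h, -⟩ := r.holds
    simp [h]
  map_mul' a b := Universal.ext_lift fun r => by
    obtain ⟨ν, μ, -, h, -⟩ := r.holds
    simp [h]
  map_zero' := Universal.ext_lift fun r => by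
    obtain ⟨ν, μ, -, h, -⟩ := r.holds
    simp [h]
  map_add' a b := Universal.ext_lift fun r => by
    obtain ⟨ν, μ, -, h, -⟩ := r.holds
    simp [h]
  commutes' z := Universal.ext_lift fun r => by
    obtain ⟨ν, μ, -, h, -⟩ := r.holds
    simp [h, AlgHomClass.commutes]
  map_star' a := Universal.ext_lift fun r => by
    obtain ⟨ν, μ, -, h, -⟩ := r.holds
    simp [h, map_star]

/-- A character of `A *_w H` is a family of characters of `A` together with one of `H`. -/
theorem bijective_characters : Function.Bijective
    fun φ : FreeWreath A m →⋆ₐ[ℂ] ℂ => ((fun k => φ.comp (ν m k), φ.comp (μ m)) :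
      (n → (A →⋆ₐ[ℂ] ℂ)) × (H →⋆ₐ[ℂ] ℂ)) := by
  refine ⟨fun φ ψ h => Universal.starAlgHom_ext ?_, fun ⟨α, β⟩ => ?_⟩
  · rw [Prod.mk.injEq] at h
    rintro (⟨k, a⟩ | b)
    · exact DFunLike.congr_fun (congrFun h.1 k) a
    · exact DFunLike.congr_fun h.2 b
  · obtain ⟨φ, hφ⟩ := CStarRelations.exists_character (R := freeWreathRelations A m)
      (ρ := Sum.elim (fun p => α p.1 p.2) β)
      ⟨fun k => toScalars.comp (α k), toScalars.comp β, fun _ _ => rfl, fun _ => rfl,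
        -- The commutation relation is automatic because the target is commutative.
        fun _ _ _ => mul_comm _ _⟩
    exact ⟨φ, Prod.ext (funext fun k => StarAlgHom.ext fun a => hφ (Sum.inl (k, a)))
      (StarAlgHom.ext fun b => hφ (Sum.inr b))⟩

end FreeWreath

namespace SimpleGraph

variable {V : Type u} {W : Type v}

/-- An isomorphism between `A(X ∘ Y)` and `A(X) *_w A(Y)` forces the orders of `Aut(X ∘ Y)` and of
`Aut(X) ≀ Aut(Y)` to agree. -/
theorem card_autWreath_of_starAlgEquiv [Fintype V] [Fintype W]
    (X : SimpleGraph V) (Y : SimpleGraph W)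
    (f : QAut (X.lexProd Y) ≃⋆ₐ[ℂ] FreeWreath (QAut X) (QAut.u Y)) :
    Nat.card (X.AutWreath Y) = Nat.card (X.lexProd Y ≃g X.lexProd Y) := by
  have h : Nat.card (QAut (X.lexProd Y) →⋆ₐ[ℂ] ℂ) =
      Nat.card (FreeWreath (QAut X) (QAut.u Y) →⋆ₐ[ℂ] ℂ) :=
    Nat.card_eq_of_bijective
      (fun φ => φ.comp (f.symm : FreeWreath (QAut X) (QAut.u Y) →⋆ₐ[ℂ] QAut (X.lexProd Y)))
      ⟨fun φ ψ h => StarAlgHom.ext fun a => by simpa using DFunLike.congr_fun h (f a),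
        fun ψ => ⟨ψ.comp (f : QAut (X.lexProd Y) →⋆ₐ[ℂ] FreeWreath (QAut X) (QAut.u Y)),
          StarAlgHom.ext fun a => by simp⟩⟩
  rw [Nat.card_eq_of_bijective _ (FreeWreath.bijective_characters (QAut.u Y)), QAut.card_character,
    Nat.card_prod, Nat.card_fun, QAut.card_character, QAut.card_character] at h
  rw [SemidirectProduct.card, Nat.card_fun, h]

/-! ### The canonical homomorphism from the wreath product -/

/-- The canonical homomorphism `Aut(X) ≀ Aut(Y) → Aut(X ∘ Y)`. -/
def wreathHom (X : SimpleGraph V) (Y : SimpleGraph W) :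
    X.AutWreath Y →* (X.lexProd Y ≃g X.lexProd Y) :=
  MonoidHom.mk' (fun g =>
    { toFun := fun p => (g.left (g.right p.2) p.1, g.right p.2)
      invFun := fun p => ((g.left p.2)⁻¹ p.1, g.right⁻¹ p.2)
      left_inv := fun p => by simp
      right_inv := fun p => by simp
      map_rel_iff' := by
        rintro ⟨i, a⟩ ⟨j, b⟩
        simp only [lexProd, Equiv.coe_fn_mk, EmbeddingLike.apply_eq_iff_eq, Iso.map_adj_iff]
        refine or_congr_left (and_congr_right ?_)
        rintro rfl
        exact (g.left (g.right a)).map_adj_iff }) fun g h => by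
    refine RelIso.ext fun p => ?_
    simp [SemidirectProduct.mul_left, SemidirectProduct.mul_right]
    change h.left (g.right⁻¹ (g.right (h.right p.2))) p.1 = _
    rw [RelIso.inv_apply_self]

theorem wreathHom_apply (X : SimpleGraph V) (Y : SimpleGraph W) (g : X.AutWreath Y) (i : V) (a : W) :
    wreathHom X Y g (i, a) = (g.left (g.right a) i, g.right a) := rfl

/-- If `V` is empty then so is the vertex set of `X ∘ Y`, and the `Aut(Y)` factor acts trivially;
this is why the alternative is needed. -/
theorem wreathHom_injective (X : SimpleGraph V) (Y : SimpleGraph W)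
    (h : Nonempty V ∨ Subsingleton (Y ≃g Y)) : Function.Injective (wreathHom X Y) := by
  intro g g' hg
  have key : ∀ i a, (g.left (g.right a) i, g.right a) = (g'.left (g'.right a) i, g'.right a) :=
    fun i a => DFunLike.congr_fun hg (i, a)
  have hr : g.right = g'.right := by
    obtain ⟨⟨i⟩⟩ | h := h
    · exact RelIso.ext fun a => (Prod.ext_iff.1 (key i a)).2
    · exact Subsingleton.elim _ _
  refine SemidirectProduct.ext (funext fun b => RelIso.ext fun i => ?_) hr
  have := (Prod.ext_iff.1 (key i (g.right⁻¹ b))).1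
  rw [← hr] at this
  simpa using this

/-! ### Twins -/

open Classical in
-- Only one endpoint is moved, so different permutations may later be applied to the two endpoints
-- of an edge.
theorem swap_adj_iff {Y : SimpleGraph W} {y₀ y₁ : W} (h : Y.neighborSet y₀ = Y.neighborSet y₁)
    (a b : W) : Y.Adj (Equiv.swap y₀ y₁ a) b ↔ Y.Adj a b := by
  have h' : ∀ b, Y.Adj y₀ b ↔ Y.Adj y₁ b := fun b => Set.ext_iff.1 h b
  rw [Equiv.swap_apply_def]
  split_ifs with h0 h1
  · rw [h0, h']
  · rw [h1, h']
  · rfl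

theorem lexProd_compl (X : SimpleGraph V) (Y : SimpleGraph W) :
    (X.lexProd Y)ᶜ = Xᶜ.lexProd Yᶜ := by
  ext ⟨i, a⟩ ⟨j, b⟩
  simp only [lexProd, compl_adj, ne_eq, Prod.mk.injEq]
  by_cases h : a = b
  · subst h; simp
  · simp [h]

theorem twinPairs_compl (Y : SimpleGraph W) : Yᶜ.twinPairs = Y.closedTwinPairs := by
  ext ⟨a, b⟩
  simp only [twinPairs, closedTwinPairs, Set.mem_ofPred_eq, Set.ext_iff, Set.mem_insert_iff,
    mem_neighborSet, compl_adj]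
  refine and_congr_left fun _ => forall_congr' fun c => ?_
  grind

/-- An automorphism of the complement is an automorphism. -/
def isoOfCompl {X : SimpleGraph V} (f : Xᶜ ≃g Xᶜ) : X ≃g X where
  toEquiv := f.toEquiv
  map_rel_iff' {a b} := by
    have h := f.map_adj_iff (v := a) (w := b)
    have h' : f a = f b ↔ a = b := f.injective.eq_iff
    have e1 : f a = f b → ¬ X.Adj (f a) (f b) := fun e => e ▸ X.irrefl
    have e2 : a = b → ¬ X.Adj a b := fun e => e ▸ X.irrefl
    simp only [compl_adj, ne_eq] at h
    change X.Adj (f a) (f b) ↔ X.Adj a b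
    tauto

theorem nontrivial_aut_of_twinPairs {Y : SimpleGraph W} (h : Y.twinPairs.Nonempty) :
    Nontrivial (Y ≃g Y) := by
  classical
  obtain ⟨⟨y₀, y₁⟩, h, hne⟩ := h
  let f : Y ≃g Y := ⟨Equiv.swap y₀ y₁, fun {a b} => by
    rw [swap_adj_iff h, Y.adj_comm, swap_adj_iff h, Y.adj_comm]⟩
  refine ⟨f, 1, fun e => hne ?_⟩
  have : f y₀ = y₀ := DFunLike.congr_fun e y₀
  exact this.symm.trans (Equiv.swap_apply_left y₀ y₁)

/-- If `Y` has twins and every automorphism of `X ∘ Y` permutes the copies of `X`, then `X` is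
connected. -/
theorem connected_of_twinPairs [Nonempty V] {X : SimpleGraph V} {Y : SimpleGraph W}
    (hf : ∀ (f : X.lexProd Y ≃g X.lexProd Y) (i j : V) (a : W), (f (i, a)).2 = (f (j, a)).2)
    (hY : Y.twinPairs.Nonempty) : X.Connected := by
  classical
  obtain ⟨⟨y₀, y₁⟩, h, hne⟩ := hY
  refine (connected_iff_exists_forall_reachable X).2 ⟨Classical.arbitrary V, fun j => ?_⟩
  set i := Classical.arbitrary V
  by_contra hj
  -- The twins are exchanged only over the component of `i`; `j` lies outside it, so the copy of `X`
  -- over `y₀` gets split.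
  let t : V → Equiv.Perm W := fun k => if X.Reachable i k then Equiv.swap y₀ y₁ else 1
  have ht : ∀ k a b, Y.Adj (t k a) b ↔ Y.Adj a b := fun k a b => by
    simp only [t]
    split_ifs
    · exact swap_adj_iff h a b
    · rfl
  let f : X.lexProd Y ≃g X.lexProd Y :=
    { toFun := fun p => (p.1, t p.1 p.2)
      invFun := fun p => (p.1, (t p.1).symm p.2)
      left_inv := fun p => by simp
      right_inv := fun p => by simp
      map_rel_iff' := by
        rintro ⟨k, a⟩ ⟨l, b⟩
        simp only [lexProd, Equiv.coe_fn_mk]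
        rw [ht, Y.adj_comm, ht, Y.adj_comm]
        refine or_congr_left (and_congr_left fun hkl => ?_)
        -- Adjacent vertices of `X` share a component, so edges inside a copy are preserved.
        have : t k = t l := by
          simp only [t]
          congr 1
          exact propext ⟨fun h => h.trans hkl.reachable, fun h => h.trans hkl.symm.reachable⟩
        rw [this, EmbeddingLike.apply_eq_iff_eq] }
  have := hf f i j y₀
  change t i y₀ = t j y₀ at this
  simp only [t, if_pos (Reachable.refl i), if_neg hj, Equiv.swap_apply_left,
    Equiv.Perm.one_apply] at this
  exact hne this.symm

end SimpleGraph

theorem mainTheorem2 {V : Type u} {W : Type v} [Fintype V] [Fintype W]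
    (X : SimpleGraph V) (Y : SimpleGraph W)
    (hiso : Nonempty (QAut (X.lexProd Y) ≃⋆ₐ[ℂ] FreeWreath (QAut X) (QAut.u Y))) :
    (∃ e : X.AutWreath Y ≃* (X.lexProd Y ≃g X.lexProd Y),
      ∀ (g : X.AutWreath Y) (i : V) (a : W),
        e g (i, a) = (g.left (g.right a) i, g.right a)) ∧
    (Y.twinPairs.Nonempty → X.Connected) ∧
    (Y.closedTwinPairs.Nonempty → Xᶜ.Connected) := by
  obtain ⟨f⟩ := hiso
  have hcard := SimpleGraph.card_autWreath_of_starAlgEquiv X Y f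
  -- With `V` empty the equality of orders reads `|Aut(Y)| = 1`.
  have hsub : IsEmpty V → Subsingleton (Y ≃g Y) := fun _ => by
    have : Subsingleton (X ≃g X) := DFunLike.coe_injective.subsingleton
    have : Subsingleton (X.lexProd Y ≃g X.lexProd Y) := DFunLike.coe_injective.subsingleton
    rw [SemidirectProduct.card, Nat.card_unique (α := W → (X ≃g X)),
      Nat.card_unique (α := X.lexProd Y ≃g X.lexProd Y), one_mul] at hcard
    exact (Nat.card_eq_one_iff_unique.1 hcard).1
  have hinj := SimpleGraph.wreathHom_injective X Y ((isEmpty_or_nonempty V).symm.imp_right hsub)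
  have : Finite (X.lexProd Y ≃g X.lexProd Y) := DFunLike.finite _
  have hbij : Function.Bijective (SimpleGraph.wreathHom X Y) :=
    hinj.bijective_of_nat_card_le hcard.ge
  have hfib : ∀ (f : X.lexProd Y ≃g X.lexProd Y) (i j : V) (a : W),
      (f (i, a)).2 = (f (j, a)).2 := fun f i j a => by
    obtain ⟨g, rfl⟩ := hbij.2 f
    rfl
  refine ⟨⟨MulEquiv.ofBijective _ hbij, SimpleGraph.wreathHom_apply X Y⟩, fun hS => ?_, fun hT => ?_⟩
  · obtain _ | _ := isEmpty_or_nonempty V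
    · have := SimpleGraph.nontrivial_aut_of_twinPairs hS
      exact absurd (hsub ‹_›) (not_subsingleton _)
    · exact SimpleGraph.connected_of_twinPairs hfib hS
  · rw [← SimpleGraph.twinPairs_compl] at hT
    obtain _ | _ := isEmpty_or_nonempty V
    · have := SimpleGraph.nontrivial_aut_of_twinPairs hT
      have := hsub ‹_›
      obtain ⟨f, g, hne⟩ := exists_pair_ne (Yᶜ ≃g Yᶜ)
      refine absurd (RelIso.ext fun a => ?_) hne
      exact DFunLike.congr_fun (Subsingleton.elim (SimpleGraph.isoOfCompl f) (SimpleGraph.isoOfCompl g)) a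
    · refine SimpleGraph.connected_of_twinPairs (Y := Yᶜ) ?_ hT
      -- Automorphisms of `Xᶜ ∘ Yᶜ` are those of `X ∘ Y`, so they also permute the copies.
      rw [← SimpleGraph.lexProd_compl]
      exact fun f => hfib (SimpleGraph.isoOfCompl f)
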